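/- Let $\mu$ be the unique Borel probability measure on $\mathbb{R}$ such that $\mu(E)=\frac12\left(\mu(\tau_0^{-1}E)+\mu(\tau_2^{-1}E)\right)$ for all Borel sets $E\subset\mathbb{R}$, where $\tau_0(x)=x/4$ and $\tau_2(x)=(x+2)/4$. For an odd natural number $m$ let $\Gamma(m)=\left\{\sum_{k=0}^n 4^k l_k : n\ge 0,\ l_k\in\{0,m\}\right\}$, and call $m$ complete if the exponentials $e_\lambda(x)=e^{2\pi i\lambda x}$, $\lambda\in\Gamma(m)$, form an orthonormal basis of $L^2(\mu)$. Let $o_4(m)$ denote the smallest positive integer $r$ with $4^r\equiv 1\pmod m$. A prime $p\ge 3$ is called simple if $o_4(p)<o_4(p^2)$. Let $a$ be a complete odd number and let $p>3$ be a simple prime. Assume that (i) $p$ does not divide $a$; (ii) $\gcd(o_4(p),o_4(a))=1$; (iii) $o_4(p)>2^{\lceil\log_2\sqrt{p/3}\,\rceil}$. Then $p^k a$ is complete for all $k\ge 0$. Moreover, condition (iii) holds for every prime $p>5$ with $o_4(p)=\frac{p-1}{2}$. -/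

import Mathlib

open MeasureTheory

namespace CantorFourier

noncomputable section

/-- The maps `τ_d(x) = (x + d) / 4`. The fractal measure uses `τ_0` and `τ_2`. -/
def tau (d x : ℝ) : ℝ := (x + d) / 4

/-- `μ` is a Borel probability measure on `ℝ` that is invariant for the iterated function system
`{τ_0, τ_2}` with equal weights. -/
def IsInvariantProbability (μ : Measure ℝ) : Prop :=
  IsProbabilityMeasure μ ∧
    ∀ E : Set ℝ, MeasurableSet E → μ E = (1 / 2) * (μ (tau 0 ⁻¹' E) + μ (tau 2 ⁻¹' E))

/-! ### Existence: the law of a random base-four expansion with fair digits in `{0, 2}` -/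

/-- A fair coin. -/
def coin : Measure Bool :=
  (1 / 2 : ENNReal) • Measure.dirac false + (1 / 2 : ENNReal) • Measure.dirac true

instance : IsProbabilityMeasure coin :=
  ⟨by simp [coin, ENNReal.inv_two_add_inv_two]⟩

/-- Put a bit in front of a sequence of bits. -/
def consBit (b : Bool) (w : ℕ → Bool) : ℕ → Bool
  | 0 => b
  | n + 1 => w n

/-- The number with a given sequence of base-four digits in `{0, 2}`. -/
def digitSum (w : ℕ → Bool) : ℝ := ∑' k : ℕ, cond (w k) (2 : ℝ) 0 * (1 / 4) ^ (k + 1)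

theorem measurable_consBit (b : Bool) : Measurable (consBit b) := by
  refine measurable_pi_iff.2 fun n => ?_
  cases n with
  | zero => exact measurable_const
  | succ n => exact measurable_pi_apply n

theorem summable_digits (w : ℕ → Bool) :
    Summable fun k : ℕ => cond (w k) (2 : ℝ) 0 * (1 / 4) ^ (k + 1) := by
  have h : Summable fun k : ℕ => 2 * ((1 : ℝ) / 4) ^ (k + 1) :=
    (((summable_geometric_of_lt_one (r := (1 / 4 : ℝ)) (by norm_num) (by norm_num)).comp_injective
      (add_left_injective 1))).mul_left 2
  refine Summable.of_nonneg_of_le (fun k => ?_) (fun k => ?_) h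
  · cases w k <;> simp
  · gcongr
    cases w k <;> simp

theorem measurable_digitSum : Measurable digitSum := by
  have hm : ∀ k : ℕ, Measurable fun w : ℕ → Bool =>
      cond (w k) (2 : ℝ) 0 * (1 / 4) ^ (k + 1) := fun k =>
    ((measurable_of_finite fun b : Bool => cond b (2 : ℝ) 0).comp
      (measurable_pi_apply k)).mul_const _
  refine measurable_of_tendsto_metrizable
    (f := fun n w => ∑ k ∈ Finset.range n, cond (w k) (2 : ℝ) 0 * (1 / 4) ^ (k + 1))
    (fun n => Finset.measurable_sum _ fun k _ => hm k) ?_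
  exact tendsto_pi_nhds.2 fun w => (summable_digits w).hasSum.tendsto_sum_nat

theorem digitSum_consBit (b : Bool) (w : ℕ → Bool) :
    digitSum (consBit b w) = tau (cond b 2 0) (digitSum w) := by
  have h := (summable_digits (consBit b w)).tsum_eq_zero_add
  unfold digitSum tau
  rw [h]
  have h2 : ∀ k : ℕ, cond (consBit b w (k + 1)) (2 : ℝ) 0 * (1 / 4) ^ (k + 1 + 1)
      = (cond (w k) (2 : ℝ) 0 * (1 / 4) ^ (k + 1)) * (1 / 4) := fun k => by
    simp only [consBit]; ring
  simp only [h2, tsum_mul_right]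
  simp only [consBit]
  ring

/-- The law of a sequence of independent fair coins. -/
def coins : Measure (ℕ → Bool) := Measure.infinitePi fun _ : ℕ => coin

instance : IsProbabilityMeasure coins := by unfold coins; infer_instance

theorem coins_eq :
    (1 / 2 : ENNReal) • coins.map (consBit false) + (1 / 2 : ENNReal) • coins.map (consBit true)
      = coins := by
  refine Measure.eq_infinitePi _ fun s t ht => ?_
  classical
  obtain ⟨n, hn⟩ := s.exists_nat_subset_range
  set t' : ℕ → Set Bool := fun i => if i ∈ s then t i else Set.univ with ht'
  have hmt' : ∀ i, MeasurableSet (t' i) := fun i => by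
    simp only [ht']; split_ifs
    exacts [ht i, MeasurableSet.univ]
  have hset : Set.pi (s : Set ℕ) t = Set.pi (Finset.range (n + 1) : Set ℕ) t' := by
    ext w
    simp only [Set.mem_pi, Finset.mem_coe, Finset.mem_range, ht']
    constructor
    · intro h i _
      split_ifs with hi
      exacts [h i hi, Set.mem_univ _]
    · intro h i hi
      have := h i (by have := Finset.mem_range.1 (hn hi); omega)
      simpa [hi] using this
  have hprod : ∏ i ∈ s, coin (t i) = ∏ i ∈ Finset.range (n + 1), coin (t' i) := by
    have hs : s ⊆ Finset.range (n + 1) := hn.trans (Finset.range_mono (Nat.le_succ n))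
    rw [← Finset.prod_subset hs (f := fun i => coin (t' i))
      (fun i _ hi => by simp only [ht', hi, if_false]; exact measure_univ)]
    exact Finset.prod_congr rfl fun i hi => by simp [ht', hi]
  have hpre : ∀ b : Bool, coins (consBit b ⁻¹' Set.pi (Finset.range (n + 1) : Set ℕ) t')
      = Measure.dirac b (t' 0) * ∏ i ∈ Finset.range n, coin (t' (i + 1)) := fun b => by
    have hiff : ∀ w : ℕ → Bool, w ∈ consBit b ⁻¹' Set.pi (Finset.range (n + 1) : Set ℕ) t' ↔
        b ∈ t' 0 ∧ w ∈ Set.pi (Finset.range n : Set ℕ) (fun i => t' (i + 1)) := fun w => by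
      simp only [Set.mem_preimage, Set.mem_pi, Finset.mem_coe, Finset.mem_range]
      constructor
      · exact fun h => ⟨h 0 (by omega), fun i hi => h (i + 1) (by omega)⟩
      · rintro ⟨h0, h⟩ i hi
        cases i with
        | zero => exact h0
        | succ i => exact h i (by omega)
    rw [Measure.dirac_apply' _ (hmt' 0)]
    by_cases hb : b ∈ t' 0
    · have : consBit b ⁻¹' Set.pi (Finset.range (n + 1) : Set ℕ) t'
          = Set.pi (Finset.range n : Set ℕ) (fun i => t' (i + 1)) := by
        ext w; rw [hiff]; simp [hb]
      rw [this, coins, Measure.infinitePi_pi _ (fun i _ => hmt' (i + 1))]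
      simp [hb]
    · have : consBit b ⁻¹' Set.pi (Finset.range (n + 1) : Set ℕ) t' = ∅ := by
        ext w; rw [hiff]; simp [hb]
      rw [this]
      simp [hb]
  have hmpi : MeasurableSet (Set.pi (Finset.range (n + 1) : Set ℕ) t') :=
    MeasurableSet.pi (Finset.countable_toSet _) fun i _ => hmt' i
  rw [hset, hprod, Finset.prod_range_succ', Measure.add_apply, Measure.smul_apply,
    Measure.smul_apply, Measure.map_apply (measurable_consBit _) hmpi,
    Measure.map_apply (measurable_consBit _) hmpi, hpre, hpre]
  simp only [coin, Measure.add_apply, Measure.smul_apply, smul_eq_mul]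
  ring

theorem isInvariantProbability_map : IsInvariantProbability (coins.map digitSum) := by
  refine ⟨Measure.isProbabilityMeasure_map measurable_digitSum.aemeasurable, fun E hE => ?_⟩
  have ht : ∀ d : ℝ, MeasurableSet (tau d ⁻¹' E) := fun d => by
    have : Measurable (tau d) := by unfold tau; fun_prop
    exact this hE
  have hb : ∀ b : Bool, consBit b ⁻¹' (digitSum ⁻¹' E)
      = digitSum ⁻¹' (tau (cond b 2 0) ⁻¹' E) := fun b => by
    ext w; simp only [Set.mem_preimage, digitSum_consBit]
  rw [Measure.map_apply measurable_digitSum hE, Measure.map_apply measurable_digitSum (ht 0),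
    Measure.map_apply measurable_digitSum (ht 2)]
  conv_lhs => rw [← coins_eq]
  rw [Measure.add_apply, Measure.smul_apply, Measure.smul_apply,
    Measure.map_apply (measurable_consBit _) (measurable_digitSum hE),
    Measure.map_apply (measurable_consBit _) (measurable_digitSum hE), hb, hb]
  simp [mul_add]

/-! ### Uniqueness: the characteristic function is determined -/

theorem charFun_invariant {μ : Measure ℝ} (h : IsInvariantProbability μ) (t : ℝ) :
    charFun μ t =
      (1 + Complex.exp (t / 2 * Complex.I)) / 2 * charFun μ (t / 4) := by
  have := h.1
  have hm : ∀ d : ℝ, Measurable (tau d) := fun d => by unfold tau; fun_prop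
  have hμ : μ = (1 / 2 : ENNReal) • (μ.map (tau 0) + μ.map (tau 2)) := by
    ext E hE
    rw [h.2 E hE, Measure.smul_apply, Measure.add_apply, Measure.map_apply (hm 0) hE,
      Measure.map_apply (hm 2) hE, smul_eq_mul]
  have hI : ∀ d : ℝ, ∫ x, Complex.exp (t * x * Complex.I) ∂(μ.map (tau d))
      = Complex.exp (t * d / 4 * Complex.I) * charFun μ (t / 4) := fun d => by
    rw [integral_map (hm d).aemeasurable (by fun_prop), charFun_apply_real,
      ← integral_const_mul]
    refine integral_congr_ae (Filter.Eventually.of_forall fun x => ?_)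
    simp only [tau]
    rw [← Complex.exp_add]
    push_cast
    ring_nf
  have hint : ∀ d : ℝ, Integrable (fun x : ℝ => Complex.exp (t * x * Complex.I))
      (μ.map (tau d)) := fun d => by
    have : IsProbabilityMeasure (μ.map (tau d)) :=
      Measure.isProbabilityMeasure_map (hm d).aemeasurable
    refine Integrable.of_bound (C := 1) (by fun_prop) (Filter.Eventually.of_forall fun x => ?_)
    rw [← Complex.ofReal_mul, Complex.norm_exp_ofReal_mul_I]
  rw [charFun_apply_real]
  conv_lhs => rw [hμ]
  rw [integral_smul_measure, integral_add_measure (hint 0) (hint 2), hI, hI]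
  simp only [ENNReal.toReal_div, ENNReal.toReal_one, ENNReal.toReal_ofNat, Complex.real_smul]
  push_cast
  simp only [mul_zero, zero_div, zero_mul, Complex.exp_zero]
  rw [show (t : ℂ) * 2 / 4 = t / 2 by ring]
  ring

theorem isInvariantProbability_unique {μ ν : Measure ℝ} (hμ : IsInvariantProbability μ)
    (hν : IsInvariantProbability ν) : μ = ν := by
  have := hμ.1
  have := hν.1
  have key : ∀ t : ℝ, ‖charFun μ t - charFun ν t‖
      ≤ ‖charFun μ (t / 4) - charFun ν (t / 4)‖ := fun t => by
    rw [charFun_invariant hμ t, charFun_invariant hν t, ← mul_sub, norm_mul]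
    refine mul_le_of_le_one_left (norm_nonneg _) ?_
    have h1 : ‖Complex.exp ((t : ℂ) / 2 * Complex.I)‖ = 1 := by
      have := Complex.norm_exp_ofReal_mul_I (t / 2)
      push_cast at this
      exact this
    have h2 := norm_add_le (1 : ℂ) (Complex.exp ((t : ℂ) / 2 * Complex.I))
    rw [h1, norm_one] at h2
    rw [norm_div, Complex.norm_ofNat]
    linarith
  refine Measure.ext_of_charFun (funext fun t => ?_)
  have hn : ∀ n : ℕ, ‖charFun μ t - charFun ν t‖
      ≤ ‖charFun μ (t * (1 / 4) ^ n) - charFun ν (t * (1 / 4) ^ n)‖ := fun n => by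
    induction n with
    | zero => simp
    | succ n ih =>
      refine ih.trans ((key _).trans_eq ?_)
      rw [show t * (1 / 4 : ℝ) ^ n / 4 = t * (1 / 4) ^ (n + 1) by ring]
  have hlim : Filter.Tendsto (fun n : ℕ => t * (1 / 4 : ℝ) ^ n) Filter.atTop (nhds 0) := by
    simpa using (tendsto_pow_atTop_nhds_zero_of_lt_one (r := (1 / 4 : ℝ)) (by norm_num)
      (by norm_num)).const_mul t
  have hc : Continuous fun s : ℝ => ‖charFun μ s - charFun ν s‖ :=
    (continuous_charFun.sub continuous_charFun).norm
  have h0 := ge_of_tendsto ((hc.tendsto 0).comp hlim) (Filter.Eventually.of_forall hn)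
  simp only [charFun_zero, probReal_univ, sub_self, norm_zero] at h0
  exact sub_eq_zero.1 (norm_le_zero_iff.1 h0)

theorem existsUnique_isInvariantProbability : ∃! μ : Measure ℝ, IsInvariantProbability μ :=
  ⟨_, isInvariantProbability_map, fun _ h => isInvariantProbability_unique h
    isInvariantProbability_map⟩

/-! ### The notions of the statement -/

/-- The fractal measure: the unique Borel probability measure on `ℝ` with
`μ(E) = (μ(τ_0⁻¹ E) + μ(τ_2⁻¹ E)) / 2` for all Borel sets `E`. -/
def cantorMeasure : Measure ℝ := existsUnique_isInvariantProbability.choose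

theorem isInvariantProbability_cantorMeasure : IsInvariantProbability cantorMeasure :=
  existsUnique_isInvariantProbability.choose_spec.1

/-- `Γ` is a spectrum of `μ`: the exponentials `e_γ(x) = exp(2πiγx)`, `γ ∈ Γ`, form an orthonormal
(Hilbert) basis of the complex Hilbert space `L²(μ)`. -/
def IsSpectrum (μ : Measure ℝ) (Γ : Set ℝ) : Prop :=
  ∃ b : HilbertBasis Γ ℂ (Lp ℂ 2 μ), ∀ γ : Γ,
    (b γ : ℝ → ℂ) =ᵐ[μ] fun x : ℝ => Complex.exp (2 * Real.pi * Complex.I * (γ : ℝ) * x)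

/-- `Γ(m)`: the numbers `∑_{k=0}^n 4^k l_k` with digits `l_k ∈ {0, m}`. -/
def Gam (m : ℕ) : Set ℝ :=
  {x | ∃ (n : ℕ) (l : ℕ → ℝ), (∀ k, l k = 0 ∨ l k = m) ∧
    x = ∑ k ∈ Finset.range (n + 1), 4 ^ k * l k}

/-- A natural number `m` is a complete odd number if it is odd and `Γ(m)` is a spectrum of the
fractal measure. -/
def IsCompleteOdd (m : ℕ) : Prop := Odd m ∧ IsSpectrum cantorMeasure (Gam m)

/-- `o_4(m)`: the smallest positive integer `a` with `4^a ≡ 1 (mod m)`, for odd `m`. -/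
def o4 (m : ℕ) : ℕ := orderOf (4 : ZMod m)

/-- A simple prime: a prime `p ≥ 3` with `o_4(p) < o_4(p²)`. -/
def IsSimplePrime (p : ℕ) : Prop := p.Prime ∧ 3 ≤ p ∧ o4 p < o4 (p ^ 2)

end

end CantorFourier

namespace CantorFourier

/-! Completeness is turned into arithmetic (`isCompleteOdd_iff`): an odd `m` is complete exactly
when no orbit `4 ^ j * x` outside the zero class keeps all its residues in the first third of `[0,
m)`.

If such an orbit exists and `y` is one of its residues, then `-y` behaves 2-adically like an
infinite expansion with digits in `{0, m}`, so `e_{-y}` is a unit vector orthogonal to every `e_γ`.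
Conversely, let `spectralSum m t` be the sum of the squared coefficients of `e_{-t}`. It is at most
1 by Bessel, equals 1 at 0, and is an average, with weights cos² and sin², of its values at `t / 4`
and `(t + m) / 4`. If its minimum on a large interval were below 1, the minimizers would be closed
under every move of positive weight and would avoid 0. This forces them to be integers, finite in
number, and a periodic chain among them is an extreme orbit. So the sum is identically 1, and the
exponentials are total.

For the arithmetic (`not_hasExtremeOrbit_pow_mul`), take an extreme orbit modulo `p ^ (k + 1) * a`.
If `p` divides `x`, one factor `p` cancels. Otherwise, coprimality of the orders makes the shifts by
multiples of `o4 a` congruent modulo `a` and yields `o4 p` distinct classes modulo `p`. For the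
exponent 1, more than `2 ^ n` points force two to share `n` digits, hence to be too close. For
larger exponents, simplicity lets a power of 4 move the difference of two shifts into the middle
third, which is impossible for points of the first third. -/

/-! ### Extreme orbits and the order of 4 modulo powers of a simple prime. -/

/-- The residues modulo `m` of all `4 ^ j * x` lie in `[0, m / 3]`, for some `x` not divisible by
`m`. Such orbits are the nontrivial extreme cycles for the digits `{0, m}`. -/
def HasExtremeOrbit (m : ℕ) : Prop :=
  ∃ x : ℤ, ¬ (m : ℤ) ∣ x ∧ ∀ j : ℕ, 3 * ((4 ^ j * x) % (m : ℤ)) ≤ m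

theorem HasExtremeOrbit.of_dvd {p n : ℕ} (hp : 0 < p) {x : ℤ} (hx : ¬ ((p * n : ℕ) : ℤ) ∣ x)
    (h : ∀ j : ℕ, 3 * ((4 ^ j * x) % ((p * n : ℕ) : ℤ)) ≤ (p * n : ℕ)) (hpx : (p : ℤ) ∣ x) :
    HasExtremeOrbit n := by
  obtain ⟨y, rfl⟩ := hpx
  have hp' : (0 : ℤ) < p := by exact_mod_cast hp
  refine ⟨y, fun hn => hx ?_, fun j => ?_⟩
  · push_cast
    exact mul_dvd_mul_left _ hn
  · have := h j
    push_cast at this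
    rw [show (4 : ℤ) ^ j * (p * y) = p * (4 ^ j * y) by ring, Int.mul_emod_mul_of_pos _ _ hp'] at this
    nlinarith

/-- `orderOf` is 0 on elements of infinite order, so this needs 4 to be a unit in a finite ring. -/
theorem o4_pos {m : ℕ} (hm : Odd m) : 0 < o4 m := by
  have h : IsUnit ((4 : ℕ) : ZMod m) := by
    rw [ZMod.isUnit_iff_coprime]
    exact (Nat.Coprime.pow_left 2 (Nat.coprime_two_left.2 hm))
  obtain ⟨u, hu⟩ := h
  have : NeZero m := ⟨by rintro rfl; simp at hm⟩
  have h4 : o4 m = orderOf u := by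
    unfold o4
    rw [show (4 : ZMod m) = ((4 : ℕ) : ZMod m) by norm_num, ← hu, orderOf_units]
  rw [h4]
  exact orderOf_pos u

theorem dvd_four_pow_sub_one_iff (m n : ℕ) : (m : ℤ) ∣ 4 ^ n - 1 ↔ o4 m ∣ n := by
  rw [o4, orderOf_dvd_iff_pow_eq_one, ← ZMod.intCast_zmod_eq_zero_iff_dvd]
  push_cast
  exact sub_eq_zero

/-- Powers of `4` fill the kernel of reduction from `p ^ (k + 2)` to `p ^ (k + 1)`. -/
theorem four_pow_eq_one_add {p : ℕ} (hp : IsSimplePrime p) (k : ℕ) :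
    ∃ u : ℤ, ¬ (p : ℤ) ∣ u ∧ (4 : ℤ) ^ (o4 p * p ^ k) = 1 + p ^ (k + 1) * u := by
  obtain ⟨hpp, hp3, hlt⟩ := hp
  have hodd : Odd p := hpp.odd_of_ne_two (by omega)
  obtain ⟨u, hu⟩ := (dvd_four_pow_sub_one_iff p (o4 p)).2 dvd_rfl
  -- This is where simplicity enters: otherwise 4 would already have order at most `o4 p` modulo `p
  -- ^ 2`.
  have hpu : ¬ (p : ℤ) ∣ u := by
    rintro ⟨v, rfl⟩
    have : ((p ^ 2 : ℕ) : ℤ) ∣ 4 ^ (o4 p) - 1 := ⟨v, by rw [hu]; push_cast; ring⟩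
    rw [dvd_four_pow_sub_one_iff] at this
    exact absurd (Nat.le_of_dvd (o4_pos hodd) this) (by omega)
  obtain ⟨y, hy⟩ := ZMod.exists_one_add_mul_pow_prime_pow_eq (u := (p : ℤ)) (v := p) hpp dvd_rfl
    (by rw [show (p : ℤ) * p * p = p ^ 3 by ring]; exact pow_dvd_pow _ hp3) u k
  refine ⟨u + p * y, fun h => hpu ((Int.dvd_add_left (dvd_mul_right _ _)).1 h), ?_⟩
  rw [pow_mul, show (4 : ℤ) ^ o4 p = 1 + p * u by linarith, hy]
  ring

/-- To first order, powers of `1 + p ^ (k + 1) * w` are `1 + i * p ^ (k + 1) * w`. With `w` and `u`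
prime to `p`, the exponent `i` reaches every lift of the class of `u` to the next power of `p`. -/
theorem exists_four_pow_modEq {p : ℕ} (hp : IsSimplePrime p) (k : ℕ) {u v : ℤ}
    (hu : ¬ (p : ℤ) ∣ u) (huv : u ≡ v [ZMOD p ^ (k + 1)]) :
    ∃ j : ℕ, 4 ^ j * u ≡ v [ZMOD p ^ (k + 2)] := by
  obtain ⟨w, hw, h⟩ := four_pow_eq_one_add hp k
  have hpi : Prime (p : ℤ) := Nat.prime_iff_prime_int.1 hp.1
  obtain ⟨c, hc⟩ := huv.dvd
  have hcop : IsCoprime (w * u) (p : ℤ) :=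
    ((hpi.coprime_iff_not_dvd).2 fun hd => (hpi.dvd_or_dvd hd).elim hw hu).symm
  obtain ⟨s, t, hst⟩ := hcop
  have hp0 : (0 : ℤ) < p := by exact_mod_cast hp.1.pos
  -- Since `s` inverts `w * u` modulo `p`, this `i` solves `i * w * u ≡ c`.
  set i : ℕ := ((c * s) % p).toNat with hi
  have hi' : (i : ℤ) = (c * s) % p := Int.toNat_of_nonneg (Int.emod_nonneg _ hp0.ne')
  have hi2 : (i : ℤ) ≡ c * s [ZMOD p] := by rw [hi']; exact Int.mod_modEq _ _
  refine ⟨o4 p * p ^ k * i, ?_⟩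
  have h1 : ∀ i : ℕ, (1 + (p : ℤ) ^ (k + 1) * w) ^ i ≡ 1 + i * ((p : ℤ) ^ (k + 1) * w)
      [ZMOD (p : ℤ) ^ (k + 2)] := fun i => by
    induction i with
    | zero => simp
    | succ i ih =>
      rw [pow_succ (1 + (p : ℤ) ^ (k + 1) * w) i]
      refine (Int.ModEq.mul_right _ ih).trans ((Int.modEq_iff_dvd).2 ⟨-((i : ℤ) * (p : ℤ) ^ k * w ^ 2), ?_⟩)
      push_cast
      ring
  rw [pow_mul, h]
  refine ((h1 i).mul_right u).trans ((Int.modEq_iff_dvd).2 ?_)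
  obtain ⟨e, he⟩ := hi2.dvd
  refine ⟨c * t + e * (w * u), ?_⟩
  have : v = u + p ^ (k + 1) * c := by linarith
  rw [this]
  have h3 : c = c * s * (w * u) + c * t * p := by linear_combination (-c) * hst
  have h4 : c * s = i + p * e := by linarith
  calc _ = (p : ℤ) ^ (k + 1) * (c - i * (w * u)) := by ring
    _ = (p : ℤ) ^ (k + 1) * ((c * s - i) * (w * u) + c * t * p) := by
      congr 1; linear_combination h3
    _ = _ := by rw [h4]; ring

/-! ### Separating orbits that stay in the first third. -/

theorem three_mul_abs_emod_sub_emod_le {d : ℤ} (hd : 0 < d) {y z : ℤ} (hy : 3 * (y % d) ≤ d)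
    (hz : 3 * (z % d) ≤ d) : 3 * |y % d - z % d| ≤ d := by
  have := Int.emod_nonneg y hd.ne'
  have := Int.emod_nonneg z hd.ne'
  rcases abs_cases (y % d - z % d) with h | h <;> linarith [h.1]

theorem one_lt_o4 {p : ℕ} (hp : p.Prime) (h3 : 3 < p) : 1 < o4 p := by
  have h0 := o4_pos (hp.odd_of_ne_two (by omega))
  by_contra h
  have h1 : (p : ℤ) ∣ 4 ^ 1 - 1 := by
    rw [dvd_four_pow_sub_one_iff, show o4 p = 1 by omega]
  have : p ∣ 3 := by norm_num at h1; exact_mod_cast h1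
  exact absurd (Nat.le_of_dvd (by norm_num) this) (by omega)

/-- Two numbers congruent modulo `a` and incongruent modulo `p` cannot have orbits that both stay
in the first third modulo `p ^ (k + 2) * a`. -/
theorem not_forall_orbit_pow {p a k : ℕ} (hp : IsSimplePrime p) (h3 : 3 < p) (ha : 0 < a)
    {y z : ℤ} (hyz : (a : ℤ) ∣ y - z) (hp' : ¬ (p : ℤ) ∣ y - z)
    (hy : ∀ j : ℕ, 3 * ((4 ^ j * y) % ((p ^ (k + 2) * a : ℕ) : ℤ)) ≤ (p ^ (k + 2) * a : ℕ))
    (hz : ∀ j : ℕ, 3 * ((4 ^ j * z) % ((p ^ (k + 2) * a : ℕ) : ℤ)) ≤ (p ^ (k + 2) * a : ℕ)) :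
    False := by
  set d : ℤ := ((p ^ (k + 2) * a : ℕ) : ℤ) with hd
  have hd' : d = (p : ℤ) ^ (k + 2) * a := by rw [hd]; push_cast; rfl
  have hp0 : (0 : ℤ) < p := by exact_mod_cast hp.1.pos
  have ha0 : (0 : ℤ) < a := by exact_mod_cast ha
  have hd0 : 0 < d := by rw [hd']; positivity
  obtain ⟨u, hu⟩ := hyz
  have hpu : ¬ (p : ℤ) ∣ u := fun h => hp' (hu ▸ h.mul_left _)
  set P : ℤ := (p : ℤ) ^ (k + 1) with hP
  have hP0 : 0 < P := by positivity
  have hu0 := Int.emod_nonneg u hP0.ne'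
  have hu1 := Int.emod_lt_of_pos u hP0
  -- The digit `l` puts `u % P + P * l` strictly between one third and two thirds of `P * p`, so no
  -- translate by a multiple of `P * p` has absolute value at most `P * p / 3`.
  set l : ℤ := p / 3 + 1 with hl
  have hl1 : (p : ℤ) + 1 ≤ 3 * l := by omega
  have hl2 : 3 * (l + 1) ≤ 2 * (p : ℤ) := by
    have : p ≠ 4 := by rintro rfl; exact absurd hp.1 (by norm_num)
    have : p ≠ 6 := by rintro rfl; exact absurd hp.1 (by norm_num)
    have : ¬ 3 ∣ p := fun h => by
      have := (Nat.prime_dvd_prime_iff_eq Nat.prime_three hp.1).1 h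
      omega
    omega
  obtain ⟨j, hj⟩ := exists_four_pow_modEq hp k (v := u % P + P * l) hpu
    ((Int.modEq_iff_dvd).2 ⟨l - u / P, by rw [← hP]; linear_combination Int.mul_ediv_add_emod u P⟩)
  have hb := three_mul_abs_emod_sub_emod_le hd0 (hy j) (hz j)
  obtain ⟨e, he⟩ := hj.symm.dvd
  have hD : (4 ^ j * y) % d - (4 ^ j * z) % d
      = a * (u % P + P * l + P * p * (e - ((4 ^ j * y) / d - (4 ^ j * z) / d))) := by
    have h1 := Int.mul_ediv_add_emod (4 ^ j * y) d
    have h2 := Int.mul_ediv_add_emod (4 ^ j * z) d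
    have h4 : (p : ℤ) ^ (k + 2) = P * p := by rw [hP]; ring
    rw [h4] at he
    generalize (4 ^ j * y) / d = q1 at *
    generalize (4 ^ j * z) / d = q2 at *
    rw [hd', h4] at h1 h2
    rw [hd', h4]
    linear_combination h1 - h2 + 4 ^ j * hu + a * he
  rw [hD, abs_mul, abs_of_pos ha0, hd',
    show (p : ℤ) ^ (k + 2) = P * p by rw [hP]; ring] at hb
  generalize e - _ = c at hb
  have hb' : 3 * |u % P + P * l + P * p * c| ≤ P * p := by
    refine le_of_mul_le_mul_left ?_ ha0
    linarith
  rw [← abs_of_pos (show (0 : ℤ) < 3 by norm_num), ← abs_mul, abs_le] at hb'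
  obtain ⟨hb1, hb2⟩ := hb'
  have hPl := mul_le_mul_of_nonneg_left hl1 hP0.le
  have hPl2 := mul_le_mul_of_nonneg_left hl2 hP0.le
  have hPp : 0 < P * p := by positivity
  rcases le_or_gt 0 c with hc | hc
  · have : 0 ≤ P * p * c := by positivity
    linarith
  · have : P * p * c ≤ P * p * (-1) := mul_le_mul_of_nonneg_left (by omega) hPp.le
    linarith

/-- Four times a residue in the first third is below `2 * d`, so reduction subtracts `d` at most
once. Which case occurs is the next base-four digit. -/
theorem mul_emod_of_residues {d : ℤ} (hd : 0 < d) {y : ℤ} (hy : 3 * (y % d) ≤ d) :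
    4 * (y % d) = (4 * y) % d ∨ 4 * (y % d) = (4 * y) % d + d := by
  have h0 := Int.emod_nonneg y hd.ne'
  have h : (4 * y) % d = (4 * (y % d)) % d := by simp [Int.mul_emod]
  rcases lt_or_ge (4 * (y % d)) d with h1 | h1
  · left; rw [h, Int.emod_eq_of_lt (by linarith) h1]
  · right
    have h2 : (4 * (y % d)) % d = 4 * (y % d) - d := by
      rw [← Int.sub_emod_right (4 * (y % d)), Int.emod_eq_of_lt (by linarith) (by linarith)]
    rw [h, h2]
    ring

/-- Orbits that agree in their first `n` base-four digits start close to each other. -/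
theorem four_pow_mul_emod_sub {d : ℤ} {y z : ℤ} (n : ℕ)
    (h : ∀ i < n, 4 * ((4 ^ i * y) % d) - (4 ^ (i + 1) * y) % d
      = 4 * ((4 ^ i * z) % d) - (4 ^ (i + 1) * z) % d) :
    4 ^ n * (y % d - z % d) = (4 ^ n * y) % d - (4 ^ n * z) % d := by
  induction n with
  | zero => simp
  | succ n ih =>
    have h1 := ih fun i hi => h i (by omega)
    have h2 := h n (by omega)
    rw [pow_succ' (4 : ℤ) n, mul_assoc, h1, ← pow_succ' (4 : ℤ) n]
    linarith

/-- More than `2 ^ n` numbers that are congruent modulo `a` and distinct modulo `p` cannot all have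
orbits in the first third modulo `p * a`, if `p < 3 * 4 ^ n`. -/
theorem not_forall_orbit_of_card {p a n : ℕ} (hp0 : 0 < p) (ha : 0 < a)
    (hn : p < 3 * 4 ^ n) {o : ℕ} (ho : 2 ^ n < o) (y : Fin o → ℤ)
    (hya : ∀ i k, (a : ℤ) ∣ y i - y k) (hyp : ∀ i k, i ≠ k → ¬ (p : ℤ) ∣ y i - y k)
    (hy : ∀ i, ∀ j : ℕ, 3 * ((4 ^ j * y i) % ((p * a : ℕ) : ℤ)) ≤ (p * a : ℕ)) : False := by
  classical
  set d : ℤ := ((p * a : ℕ) : ℤ) with hd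
  have hd' : d = (p : ℤ) * a := by rw [hd]; push_cast; rfl
  have ha0 : (0 : ℤ) < a := by exact_mod_cast ha
  have hp0' : (0 : ℤ) < p := by exact_mod_cast hp0
  have hd0 : 0 < d := by rw [hd']; positivity
  -- Only two digits are possible, so the first `n` of them take at most `2 ^ n` patterns.
  let f : Fin o → (Fin n → Bool) := fun i k =>
    decide (4 * ((4 ^ (k : ℕ) * y i) % d) = (4 ^ ((k : ℕ) + 1) * y i) % d)
  obtain ⟨i, k, hik, hf⟩ := Fintype.exists_ne_map_eq_of_card_lt f (by simpa using ho)
  have hdig : ∀ s < n, 4 * ((4 ^ s * y i) % d) - (4 ^ (s + 1) * y i) % d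
      = 4 * ((4 ^ s * y k) % d) - (4 ^ (s + 1) * y k) % d := fun s hs => by
    have h1 := congrFun hf ⟨s, hs⟩
    simp only [f, decide_eq_decide] at h1
    have hi := mul_emod_of_residues hd0 (hy i s)
    have hk := mul_emod_of_residues hd0 (hy k s)
    rw [← mul_assoc, ← pow_succ'] at hi hk
    by_cases h2 : 4 * ((4 ^ s * y i) % d) = (4 ^ (s + 1) * y i) % d
    · linarith [h1.1 h2]
    · linarith [hi.resolve_left h2, hk.resolve_left fun h => h2 (h1.2 h)]
  have hkey := four_pow_mul_emod_sub n hdig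
  have hb := three_mul_abs_emod_sub_emod_le hd0 (hy i n) (hy k n)
  obtain ⟨u, hu⟩ := hya i k
  have h1 := Int.mul_ediv_add_emod (y i) d
  have h2 := Int.mul_ediv_add_emod (y k) d
  have hD : y i % d - y k % d = a * (u - p * (y i / d - y k / d)) := by
    generalize y i / d = q1 at *
    generalize y k / d = q2 at *
    rw [hd'] at h1 h2 ⊢
    linear_combination h1 - h2 + hu
  -- The starting residues differ by a nonzero multiple of `a`. After `n` steps the gap is at least
  -- `4 ^ n * a`, which exceeds a third of `p * a`.
  have hne : u - p * (y i / d - y k / d) ≠ 0 := fun h => by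
    refine hyp i k hik ?_
    rw [hu, sub_eq_zero.1 h, mul_left_comm]
    exact dvd_mul_right _ _
  generalize u - p * (y i / d - y k / d) = w at *
  rw [← hkey, hD, abs_mul, abs_mul, abs_of_pos ha0, abs_of_pos (by positivity), hd'] at hb
  have h5 := Int.one_le_abs hne
  have hn' : (p : ℤ) < 3 * 4 ^ n := by exact_mod_cast hn
  have h6 : 4 ^ n * (a : ℤ) ≤ 4 ^ n * (a * |w|) := by
    have : (a : ℤ) * 1 ≤ a * |w| := by gcongr
    gcongr
    linarith
  have h7 := mul_lt_mul_of_pos_right hn' ha0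
  linarith

theorem not_dvd_four_pow_mul {p : ℕ} (hp : p.Prime) {x : ℤ} (hx : ¬ (p : ℤ) ∣ x) {s j : ℕ}
    (h : ¬ (p : ℤ) ∣ 4 ^ s - 1) (h2 : p ≠ 2) : ¬ (p : ℤ) ∣ 4 ^ (j + s) * x - 4 ^ j * x := by
  have hpi : Prime (p : ℤ) := Nat.prime_iff_prime_int.1 hp
  rw [show (4 : ℤ) ^ (j + s) * x - 4 ^ j * x = 4 ^ j * ((4 ^ s - 1) * x) by ring]
  intro hd
  rcases hpi.dvd_or_dvd hd with h1 | h1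
  · have h4 : (p : ℤ) ∣ 2 := hpi.dvd_of_dvd_pow (n := 2) (by norm_num; exact hpi.dvd_of_dvd_pow h1)
    exact h2 ((Nat.prime_dvd_prime_iff_eq hp Nat.prime_two).1 (by exact_mod_cast h4))
  · exact (hpi.dvd_or_dvd h1).elim h hx

theorem not_hasExtremeOrbit_pow_mul {a p : ℕ} (ha : Odd a) (hp : IsSimplePrime p) (h3 : 3 < p)
    (hcop : Nat.Coprime (o4 p) (o4 a)) {n : ℕ} (hn : p < 3 * 4 ^ n) (ho : 2 ^ n < o4 p)
    (h : ¬ HasExtremeOrbit a) (k : ℕ) : ¬ HasExtremeOrbit (p ^ k * a) := by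
  have hp2 : p ≠ 2 := by omega
  have ha0 : 0 < a := ha.pos
  induction k with
  | zero => simpa using h
  | succ k ih =>
    rintro ⟨x, hx, hor⟩
    by_cases hpx : (p : ℤ) ∣ x
    · have e : p ^ (k + 1) * a = p * (p ^ k * a) := by ring
      rw [e] at hx hor
      exact ih (HasExtremeOrbit.of_dvd hp.1.pos hx hor hpx)
    have hshift : ∀ r : ℕ, ∀ j : ℕ,
        3 * ((4 ^ j * (4 ^ r * x)) % ((p ^ (k + 1) * a : ℕ) : ℤ)) ≤ (p ^ (k + 1) * a : ℕ) :=
      fun r j => by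
        rw [← mul_assoc, ← pow_add]
        exact hor _
    have hndvd : ∀ i, 0 < i → i < o4 p → ¬ (p : ℤ) ∣ 4 ^ (o4 a * i) - 1 := fun i hi hio hd => by
      rw [dvd_four_pow_sub_one_iff] at hd
      exact absurd (Nat.le_of_dvd hi (hcop.dvd_of_dvd_mul_left hd)) (by omega)
    have hadvd : ∀ i : ℕ, (a : ℤ) ∣ 4 ^ (o4 a * i) * x - x := fun i => by
      rw [show (4 : ℤ) ^ (o4 a * i) * x - x = (4 ^ (o4 a * i) - 1) * x by ring]
      exact ((dvd_four_pow_sub_one_iff _ _).2 (dvd_mul_right _ _)).mul_right _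
    -- From exponent 2 on, two shifts suffice; at exponent 1 all `o4 p` of them are needed for the
    -- count.
    cases k with
    | succ k =>
      refine not_forall_orbit_pow hp h3 ha0 (y := 4 ^ (o4 a * 1) * x) (z := x) (hadvd 1) ?_
        (hshift _) hor
      have := not_dvd_four_pow_mul hp.1 hpx (j := 0) (hndvd 1 one_pos (one_lt_o4 hp.1 h3)) hp2
      simpa using this
    | zero =>
      rw [zero_add, pow_one] at hshift
      refine not_forall_orbit_of_card hp.1.pos ha0 hn ho (fun i => 4 ^ (o4 a * i) * x)
        (fun i j => ?_) (fun i j hij => ?_) (fun i => hshift _)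
      · have := dvd_sub (hadvd i) (hadvd j)
        rwa [sub_sub_sub_cancel_right] at this
      · have key : ∀ i j : Fin (o4 p), i < j →
            ¬ (p : ℤ) ∣ 4 ^ (o4 a * j) * x - 4 ^ (o4 a * i) * x := fun i j hlt => by
          have h1 : (i : ℕ) < j := hlt
          have := not_dvd_four_pow_mul hp.1 hpx (j := o4 a * i)
            (hndvd (j - i) (by omega) (by omega)) hp2
          rwa [← mul_add, Nat.add_sub_cancel' h1.le] at this
        rcases lt_or_gt_of_ne hij with hlt | hlt
        · rw [dvd_sub_comm]; exact key i j hlt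
        · exact key j i hlt

/-! ### The logarithmic condition in integer form and in the half-order case. -/

theorem exists_nat_of_two_zpow_lt {p : ℕ} (hp : p.Prime) (h3 : 3 < p) {o : ℕ}
    (h : (2 : ℝ) ^ ⌈Real.logb 2 (Real.sqrt ((p : ℝ) / 3))⌉ < o) :
    ∃ n : ℕ, p < 3 * 4 ^ n ∧ 2 ^ n < o := by
  have hp3 : (1 : ℝ) < (p : ℝ) / 3 := by
    rw [lt_div_iff₀ (by norm_num)]
    exact_mod_cast (by omega : 1 * 3 < p)
  have hs : 1 < Real.sqrt ((p : ℝ) / 3) := by rw [Real.lt_sqrt] <;> linarith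
  have hlog : 0 < Real.logb 2 (Real.sqrt ((p : ℝ) / 3)) := Real.logb_pos (by norm_num) hs
  obtain ⟨n, hn⟩ := Int.eq_ofNat_of_zero_le (Int.ceil_nonneg hlog.le)
  have hle : Real.logb 2 (Real.sqrt ((p : ℝ) / 3)) ≤ n := by
    have := Int.le_ceil (Real.logb 2 (Real.sqrt ((p : ℝ) / 3)))
    rw [hn] at this
    exact_mod_cast this
  rw [hn, zpow_natCast] at h
  -- The ceiling gives only `p ≤ 3 * 4 ^ n`; equality would make 3 divide the prime `p`.
  refine ⟨n, lt_of_le_of_ne ?_ fun he => ?_, by exact_mod_cast h⟩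
  · rw [Real.logb_le_iff_le_rpow (by norm_num) (by linarith), Real.rpow_natCast,
      Real.sqrt_le_left (by positivity), ← pow_mul, mul_comm n, pow_mul,
      div_le_iff₀ (by norm_num)] at hle
    norm_num at hle
    have : (p : ℝ) ≤ 3 * 4 ^ n := by linarith
    exact_mod_cast this
  · have := (Nat.prime_dvd_prime_iff_eq Nat.prime_three hp).1 (he ▸ dvd_mul_right _ _)
    omega

theorem two_zpow_ceil_logb_lt {p : ℕ} (hp : p.Prime) (h5 : 5 < p) :
    (2 : ℝ) ^ ⌈Real.logb 2 (Real.sqrt ((p : ℝ) / 3))⌉ < ((p : ℝ) - 1) / 2 := by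
  have h5' : (6 : ℝ) ≤ p := by exact_mod_cast h5
  have hs0 : 0 < Real.sqrt ((p : ℝ) / 3) := Real.sqrt_pos.2 (by linarith)
  -- The estimate by `2 * √(p / 3)` used below is slightly too weak at 7.
  by_cases h7 : p = 7
  · subst h7
    have h1 : Real.logb 2 (Real.sqrt (((7 : ℕ) : ℝ) / 3)) ≤ 1 := by
      rw [Real.logb_le_iff_le_rpow (by norm_num) hs0, Real.rpow_one,
        Real.sqrt_le_left (by norm_num)]
      norm_num
    have h2 : ⌈Real.logb 2 (Real.sqrt (((7 : ℕ) : ℝ) / 3))⌉ ≤ 1 := Int.ceil_le.2 (by simpa using h1)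
    calc _ ≤ (2 : ℝ) ^ (1 : ℤ) := zpow_le_zpow_right₀ (by norm_num) h2
      _ < _ := by norm_num
  · have h11 : 11 ≤ p := by
      by_contra h
      interval_cases p <;> first | omega | exact absurd hp (by norm_num)
    have h11' : (11 : ℝ) ≤ p := by exact_mod_cast h11
    have h1 : (2 : ℝ) ^ ⌈Real.logb 2 (Real.sqrt ((p : ℝ) / 3))⌉ < 2 * Real.sqrt ((p : ℝ) / 3) := by
      rw [← Real.rpow_intCast]
      calc _ < (2 : ℝ) ^ (Real.logb 2 (Real.sqrt ((p : ℝ) / 3)) + 1) :=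
            Real.rpow_lt_rpow_of_exponent_lt (by norm_num) (Int.ceil_lt_add_one _)
        _ = _ := by
            rw [Real.rpow_add (by norm_num), Real.rpow_logb (by norm_num) (by norm_num) hs0]
            norm_num [mul_comm]
    refine h1.trans_le ?_
    have h2 : Real.sqrt ((p : ℝ) / 3) ≤ (p - 1) / 4 := by
      rw [Real.sqrt_le_left (by linarith)]
      nlinarith
    linarith

/-! ### From finite closed sets of integers to extreme orbits. -/

/-- A choice of successors permutes its periodic points, and run backwards it is multiplication by 4
modulo `m`. The largest periodic point `M` satisfies `4 * M ≤ M + m` and the smallest `N` satisfies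
`4 * N ≥ N`, so all of them lie in `(0, m / 3]` and are their own residues. -/
theorem hasExtremeOrbit_of_finite {m : ℕ} (hm : 0 < m) {S : Set ℤ} (hf : S.Finite)
    (hne : S.Nonempty) (h0 : (0 : ℤ) ∉ S)
    (hS : ∀ z ∈ S, ∃ z' ∈ S, 4 * z' = z ∨ 4 * z' = z + m) : HasExtremeOrbit m := by
  have hfin : Finite S := hf
  choose f hfS hf4 using hS
  let F : S → S := fun z => ⟨f z z.2, hfS z z.2⟩
  set T : Set ℤ := (↑) '' Function.periodicPts F with hT
  have hTS : T ⊆ S := by rintro _ ⟨z, _, rfl⟩; exact z.2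
  have hTf : T.Finite := hf.subset hTS
  have hTne : T.Nonempty := by
    obtain ⟨z, hz⟩ := hne
    obtain ⟨i, j, hij, hne⟩ : ∃ i j : ℕ, i < j ∧ F^[i] ⟨z, hz⟩ = F^[j] ⟨z, hz⟩ := by
      have := not_injective_infinite_finite fun n : ℕ => F^[n] ⟨z, hz⟩
      simp only [Function.Injective, not_forall] at this
      obtain ⟨i, j, he, hne⟩ := this
      rcases lt_or_gt_of_ne hne with h | h
      exacts [⟨i, j, h, he⟩, ⟨j, i, h, he.symm⟩]
    refine Set.Nonempty.image _ ⟨F^[i] ⟨z, hz⟩, Function.mk_mem_periodicPts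
      (n := j - i) (by omega) ?_⟩
    rw [Function.IsPeriodicPt, Function.IsFixedPt, ← Function.iterate_add_apply,
      Nat.sub_add_cancel hij.le, hne]
  have hback : ∀ y ∈ T, ∃ y' ∈ T, 4 * y = y' ∨ 4 * y = y' + m := by
    rintro _ ⟨z, hz, rfl⟩
    obtain ⟨w, hw, rfl⟩ := (Function.bijOn_periodicPts F).surjOn hz
    exact ⟨w, ⟨w, hw, rfl⟩, hf4 w w.2⟩
  obtain ⟨M, hM, hMmax⟩ := Set.exists_max_image T id hTf hTne
  obtain ⟨N, hN, hNmin⟩ := Set.exists_min_image T id hTf hTne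
  simp only [id] at hMmax hNmin
  have hm' : (0 : ℤ) < m := by exact_mod_cast hm
  have hle : ∀ y ∈ T, 3 * y ≤ m := fun y hy => by
    obtain ⟨y', hy', h⟩ := hback M hM
    have := hMmax y' hy'
    have := hMmax y hy
    rcases h with h | h <;> linarith
  have hpos : ∀ y ∈ T, 0 < y := fun y hy => by
    obtain ⟨y', hy', h⟩ := hback N hN
    have h1 := hNmin y' hy'
    have h2 := hNmin y hy
    refine lt_of_le_of_ne ?_ fun h => h0 (hTS (h ▸ hy))
    rcases h with h | h <;> linarith
  obtain ⟨y, hy⟩ := hTne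
  refine ⟨y, fun hd => ?_, fun j => ?_⟩
  · have := Int.le_of_dvd (hpos y hy) hd
    linarith [hle y hy, hpos y hy]
  · obtain ⟨w, hw, hd⟩ : ∃ w ∈ T, w ≡ 4 ^ j * y [ZMOD m] := by
      induction j with
      | zero => exact ⟨y, hy, by simp [Int.ModEq]⟩
      | succ j ih =>
        obtain ⟨w, hw, hd⟩ := ih
        obtain ⟨w', hw', h⟩ := hback w hw
        refine ⟨w', hw', ?_⟩
        have h1 : w' ≡ 4 * w [ZMOD m] := by
          rcases h with h | h <;> rw [h]
          simp [Int.ModEq]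
        rw [pow_succ', mul_assoc]
        exact h1.trans (hd.mul_left 4)
    rw [← hd.eq, Int.emod_eq_of_lt (hpos w hw).le (by linarith [hle w hw, hpos w hw])]
    exact hle w hw

/-! ### The set `Γ(m)` -/

theorem zero_mem_Gam (m : ℕ) : (0 : ℝ) ∈ Gam m := ⟨0, fun _ => 0, by simp, by simp⟩

theorem four_mul_add_mem_Gam {m : ℕ} {x c : ℝ} (hx : x ∈ Gam m) (hc : c = 0 ∨ c = m) :
    4 * x + c ∈ Gam m := by
  obtain ⟨n, l, hl, rfl⟩ := hx
  refine ⟨n + 1, fun k => Nat.casesOn k c l, fun k => ?_, ?_⟩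
  · cases k
    exacts [hc, hl _]
  · rw [Finset.sum_range_succ' _ (n + 1), Finset.mul_sum]
    simp only [pow_zero, one_mul]
    congr 1
    exact Finset.sum_congr rfl fun k _ => by ring

theorem exists_eq_four_mul_add {m : ℕ} {x : ℝ} (hx : x ∈ Gam m) :
    ∃ y ∈ Gam m, x = 4 * y ∨ x = 4 * y + m := by
  obtain ⟨n, l, hl, rfl⟩ := hx
  have h4 : ∑ k ∈ Finset.range (n + 1), (4 : ℝ) ^ k * l k
      = 4 * ∑ k ∈ Finset.range n, 4 ^ k * l (k + 1) + l 0 := by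
    rw [Finset.sum_range_succ' _ n, Finset.mul_sum]
    simp only [pow_zero, one_mul]
    congr 1
    exact Finset.sum_congr rfl fun k _ => by ring
  refine ⟨∑ k ∈ Finset.range n, 4 ^ k * l (k + 1), ?_, ?_⟩
  · cases n with
    | zero => simpa using zero_mem_Gam m
    | succ n => exact ⟨n, fun k => l (k + 1), fun k => hl _, rfl⟩
  · rw [h4]
    rcases hl 0 with h | h <;> simp [h]

theorem exists_natCast_of_mem_Gam {m : ℕ} {x : ℝ} (hx : x ∈ Gam m) : ∃ n : ℕ, x = n := by
  obtain ⟨n, l, hl, rfl⟩ := hx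
  have : ∀ k, ∃ a : ℕ, l k = a := fun k => (hl k).elim (fun h => ⟨0, by simp [h]⟩) fun h => ⟨m, h⟩
  choose a ha using this
  exact ⟨∑ k ∈ Finset.range (n + 1), 4 ^ k * a k, by push_cast; simp [ha]⟩

theorem exists_nat_eq_four_mul_add {m n : ℕ} (hn : (n : ℝ) ∈ Gam m) :
    ∃ k : ℕ, (k : ℝ) ∈ Gam m ∧ (n = 4 * k ∨ n = 4 * k + m) := by
  obtain ⟨y, hy, h⟩ := exists_eq_four_mul_add hn
  obtain ⟨k, rfl⟩ := exists_natCast_of_mem_Gam hy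
  exact ⟨k, hy, by exact_mod_cast h⟩

/-- The nonzero integers whose `4`-free part is odd. -/
def IsFourPowMulOdd (N : ℤ) : Prop := ∃ (k : ℕ) (z : ℤ), N = 4 ^ k * (2 * z + 1)

theorem IsFourPowMulOdd.four_mul {N : ℤ} (h : IsFourPowMulOdd N) : IsFourPowMulOdd (4 * N) := by
  obtain ⟨k, z, rfl⟩ := h
  exact ⟨k + 1, z, by ring⟩

theorem isFourPowMulOdd_of_odd {N : ℤ} (h : Odd N) : IsFourPowMulOdd N := by
  obtain ⟨z, rfl⟩ := h
  exact ⟨0, z, by simp⟩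

/-- Strip equal lowest digits, each giving a factor 4, until they differ; the difference is then odd
because `m` is. -/
theorem isFourPowMulOdd_sub {m : ℕ} (hm : Odd m) {n k : ℕ} (hn : (n : ℝ) ∈ Gam m)
    (hk : (k : ℝ) ∈ Gam m) (hnk : n ≠ k) : IsFourPowMulOdd ((n : ℤ) - k) := by
  induction hs : n + k using Nat.strong_induction_on generalizing n k with
  | _ s ih =>
    obtain ⟨n', hn', h1⟩ := exists_nat_eq_four_mul_add hn
    obtain ⟨k', hk', h2⟩ := exists_nat_eq_four_mul_add hk
    have hmz : Odd (m : ℤ) := by exact_mod_cast hm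
    have hrec : n' ≠ k' → IsFourPowMulOdd (4 * ((n' : ℤ) - k')) := fun h =>
      (ih (n' + k') (by omega) hn' hk' h rfl).four_mul
    rcases h1 with rfl | rfl <;> rcases h2 with rfl | rfl
    · convert hrec (by omega) using 1; push_cast; ring
    · refine isFourPowMulOdd_of_odd ?_
      push_cast; grind
    · refine isFourPowMulOdd_of_odd ?_
      push_cast; grind
    · convert hrec (by omega) using 1; push_cast; ring

/-- Following predecessors expands `-y` with digits in `{0, m}`, so `n + y` is handled like a
difference of two elements of `Γ(m)`. Positivity of `y` makes the descent terminate. -/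
theorem isFourPowMulOdd_add {m : ℕ} (hm : Odd m) {Y : Set ℤ} (hY : ∀ y ∈ Y, 0 < y)
    (hpred : ∀ y ∈ Y, ∃ y' ∈ Y, 4 * y' = y ∨ 4 * y' = y + m) {n : ℕ} (hn : (n : ℝ) ∈ Gam m)
    {y : ℤ} (hy : y ∈ Y) : IsFourPowMulOdd (n + y) := by
  have hypos := hY y hy
  induction hs : (n + y).toNat using Nat.strong_induction_on generalizing n y with
  | _ s ih =>
    obtain ⟨n', hn', h1⟩ := exists_nat_eq_four_mul_add hn
    obtain ⟨y', hy', h2⟩ := hpred y hy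
    have hmz : Odd (m : ℤ) := by exact_mod_cast hm
    have hy'0 := hY y' hy'
    have hrec : (n : ℤ) + y = 4 * (n' + y') → IsFourPowMulOdd (n + y) := fun h => by
      rw [h]
      exact (ih (n' + y').toNat (by omega) hn' hy' hy'0 rfl).four_mul
    rcases h1 with h1 | h1 <;> rcases h2 with h2 | h2
    · exact hrec (by rw [h1]; push_cast; linarith)
    · refine isFourPowMulOdd_of_odd ?_
      rw [h1, show y = 4 * y' - m by linarith]; push_cast; grind
    · refine isFourPowMulOdd_of_odd ?_
      rw [h1, ← h2]; push_cast; grind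
    · exact hrec (by rw [h1]; push_cast; linarith)

/-- The orbit is periodic, so a predecessor is found `o4 m - 1` steps later. -/
theorem exists_pred_orbit {m : ℕ} (hm : Odd m) {x : ℤ}
    (h : ∀ j : ℕ, 3 * ((4 ^ j * x) % (m : ℤ)) ≤ m) (j : ℕ) :
    ∃ i : ℕ, 4 * ((4 ^ i * x) % (m : ℤ)) = (4 ^ j * x) % (m : ℤ) ∨
      4 * ((4 ^ i * x) % (m : ℤ)) = (4 ^ j * x) % (m : ℤ) + m := by
  have hm0 : (0 : ℤ) < m := by exact_mod_cast hm.pos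
  obtain ⟨r, hr⟩ := Nat.exists_eq_succ_of_ne_zero (o4_pos hm).ne'
  refine ⟨j + r, ?_⟩
  have hper : (4 * (4 ^ (j + r) * x)) % (m : ℤ) = (4 ^ j * x) % (m : ℤ) := by
    refine Int.ModEq.eq ((Int.modEq_iff_dvd).2 ?_)
    have := (dvd_four_pow_sub_one_iff m (r + 1)).2 (hr ▸ dvd_rfl)
    rw [show 4 ^ j * x - 4 * (4 ^ (j + r) * x) = -((4 ^ (r + 1) - 1) * (4 ^ j * x)) by ring]
    exact (this.mul_right _).neg_right
  have := mul_emod_of_residues hm0 (h (j + r))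
  rwa [hper] at this

theorem four_pow_mul_emod_pos {m : ℕ} (hm : Odd m) {x : ℤ} (hx : ¬ (m : ℤ) ∣ x) (j : ℕ) :
    0 < (4 ^ j * x) % (m : ℤ) := by
  have hm0 : (0 : ℤ) < m := by exact_mod_cast hm.pos
  refine lt_of_le_of_ne (Int.emod_nonneg _ hm0.ne') fun h => hx ?_
  have hc : IsCoprime (m : ℤ) (4 ^ j) := by
    have : Nat.Coprime m (4 ^ j) := by
      rw [show 4 = 2 ^ 2 by norm_num, ← pow_mul]
      exact (Nat.coprime_two_right.2 hm).pow_right _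
    exact_mod_cast Nat.isCoprime_iff_coprime.2 this
  exact hc.dvd_of_dvd_mul_left (Int.dvd_of_emod_eq_zero h.symm)

/-! ### Integrable functions are determined by their Fourier transforms. -/

theorem norm_exp_mul_I_mul_le {t x : ℝ} (z : ℂ) :
    ‖Complex.exp (t * x * Complex.I) * z‖ = ‖z‖ := by
  rw [norm_mul, ← Complex.ofReal_mul, Complex.norm_exp_ofReal_mul_I, one_mul]

theorem integrable_exp_mul {μ : Measure ℝ} {f : ℝ → ℂ} (hf : Integrable f μ) (t : ℝ) :
    Integrable (fun x : ℝ => Complex.exp (t * x * Complex.I) * f x) μ := by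
  refine hf.mono (by fun_prop) (Filter.Eventually.of_forall fun x => ?_)
  rw [norm_exp_mul_I_mul_le]

/-- An integrable real function with vanishing Fourier transform is zero almost everywhere. -/
theorem ae_eq_zero_of_integral_exp_mul_ofReal {μ : Measure ℝ} {f : ℝ → ℝ} (hf : Integrable f μ)
    (h : ∀ t : ℝ, ∫ x, Complex.exp (t * x * Complex.I) * (f x : ℂ) ∂μ = 0) : f =ᵐ[μ] 0 := by
  have hfin := isFiniteMeasure_withDensity_ofReal hf.2
  have hfin' := isFiniteMeasure_withDensity_ofReal hf.neg.2
  have hchar : ∀ g : ℝ → ℝ, Integrable g μ → ∀ t : ℝ,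
      charFun (μ.withDensity fun x => ENNReal.ofReal (g x)) t
        = ∫ x, Complex.exp (t * x * Complex.I) * ((max (g x) 0 : ℝ) : ℂ) ∂μ := fun g hg t => by
    rw [charFun_apply_real, integral_withDensity_eq_integral_toReal_smul₀
      hg.1.aemeasurable.ennreal_ofReal (Filter.Eventually.of_forall fun x => ENNReal.ofReal_lt_top)]
    refine integral_congr_ae (Filter.Eventually.of_forall fun x => ?_)
    simp only [ENNReal.toReal_ofReal', Complex.real_smul]
    ring
  -- The positive and negative parts are densities of finite measures with equal characteristic
  -- functions.
  have heq : (μ.withDensity fun x => ENNReal.ofReal (f x))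
      = μ.withDensity fun x => ENNReal.ofReal ((-f) x) := by
    refine Measure.ext_of_charFun (funext fun t => ?_)
    have hpos : Integrable (fun x => ((max (f x) 0 : ℝ) : ℂ)) μ := hf.pos_part.ofReal
    have hneg : Integrable (fun x => ((max ((-f) x) 0 : ℝ) : ℂ)) μ := hf.neg.pos_part.ofReal
    rw [hchar f hf, hchar (-f) hf.neg, ← sub_eq_zero,
      ← integral_sub (integrable_exp_mul hpos t) (integrable_exp_mul hneg t), ← h t]
    refine integral_congr_ae (Filter.Eventually.of_forall fun x => ?_)
    have : max (f x) 0 - max (-f x) 0 = f x := by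
      rcases le_total (f x) 0 with hx | hx <;> simp [hx]
    simp only [Pi.neg_apply, ← mul_sub]
    rw [← Complex.ofReal_sub, this]
  have hae := (withDensity_eq_iff hf.1.aemeasurable.ennreal_ofReal
    hf.neg.1.aemeasurable.ennreal_ofReal
    ((lintegral_mono fun x => Real.ofReal_le_enorm (f x)).trans_lt hf.2).ne).1 heq
  filter_upwards [hae] with x hx
  simp only [Pi.neg_apply, Pi.zero_apply] at hx ⊢
  rcases lt_trichotomy (f x) 0 with h0 | h0 | h0
  · rw [ENNReal.ofReal_of_nonpos h0.le, eq_comm, ENNReal.ofReal_eq_zero] at hx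
    linarith
  · exact h0
  · rw [ENNReal.ofReal_of_nonpos (p := -f x) (by linarith), ENNReal.ofReal_eq_zero] at hx
    linarith

/-- An integrable complex function with vanishing Fourier transform is zero almost everywhere. -/
theorem ae_eq_zero_of_integral_exp_mul {μ : Measure ℝ} {f : ℝ → ℂ} (hf : Integrable f μ)
    (h : ∀ t : ℝ, ∫ x, Complex.exp (t * x * Complex.I) * f x ∂μ = 0) : f =ᵐ[μ] 0 := by
  -- Conjugation turns the transform at `-t` into that of the conjugate at `t`, so the real and
  -- imaginary parts have vanishing transforms too.
  have hconj : ∀ t : ℝ, ∫ x, Complex.exp (t * x * Complex.I) * (starRingEnd ℂ) (f x) ∂μ = 0 :=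
    fun t => by
    have h1 := congrArg (starRingEnd ℂ) (h (-t))
    rw [← integral_conj, map_zero] at h1
    rw [← h1]
    refine integral_congr_ae (Filter.Eventually.of_forall fun x => ?_)
    simp only [map_mul, ← Complex.exp_conj, Complex.conj_ofReal, Complex.conj_I]
    push_cast
    ring_nf
  have hfc : Integrable (fun x => (starRingEnd ℂ) (f x)) μ :=
    hf.mono (Complex.continuous_conj.comp_aestronglyMeasurable hf.1)
      (Filter.Eventually.of_forall fun x => by simp)
  have hre : (fun x => (f x).re) =ᵐ[μ] 0 := by
    refine ae_eq_zero_of_integral_exp_mul_ofReal hf.re fun t => ?_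
    have := integral_add (integrable_exp_mul hf t) (integrable_exp_mul hfc t)
    rw [h, hconj, add_zero] at this
    rw [← mul_zero (1 / 2 : ℂ), ← this, ← integral_const_mul]
    refine integral_congr_ae (Filter.Eventually.of_forall fun x => ?_)
    simp only [Complex.re_eq_add_conj]
    ring
  have him : (fun x => (f x).im) =ᵐ[μ] 0 := by
    refine ae_eq_zero_of_integral_exp_mul_ofReal hf.im fun t => ?_
    have := integral_sub (integrable_exp_mul hf t) (integrable_exp_mul hfc t)
    rw [h, hconj, sub_zero] at this
    rw [← mul_zero (1 / (2 * Complex.I) : ℂ), ← this, ← integral_const_mul]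
    refine integral_congr_ae (Filter.Eventually.of_forall fun x => ?_)
    simp only [Complex.im_eq_sub_conj]
    ring
  filter_upwards [hre, him] with x h1 h2
  exact Complex.ext h1 h2

/-! ### Exponentials in `L²(μ)` -/

instance : IsProbabilityMeasure cantorMeasure := isInvariantProbability_cantorMeasure.1

theorem memLp_exp (s : ℝ) : MemLp (fun x : ℝ => Complex.exp (2 * Real.pi * Complex.I * s * x)) 2
    cantorMeasure := by
  refine MemLp.of_bound (by fun_prop) 1 (Filter.Eventually.of_forall fun x => ?_)
  rw [show 2 * (Real.pi : ℂ) * Complex.I * s * x = ((2 * Real.pi * s * x : ℝ) : ℂ) * Complex.I by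
    push_cast; ring, Complex.norm_exp_ofReal_mul_I]

/-- The exponential `e_s` as an element of `L²(μ)`. -/
noncomputable def expLp (s : ℝ) : Lp ℂ 2 cantorMeasure := (memLp_exp s).toLp _

theorem coeFn_expLp (s : ℝ) : (expLp s : ℝ → ℂ) =ᵐ[cantorMeasure]
    fun x : ℝ => Complex.exp (2 * Real.pi * Complex.I * s * x) := (memLp_exp s).coeFn_toLp

/-- The Fourier transform of the fractal measure. -/
noncomputable def cantorFourier (t : ℝ) : ℂ := charFun cantorMeasure (2 * Real.pi * t)

theorem inner_expLp_left (s : ℝ) (f : Lp ℂ 2 cantorMeasure) :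
    inner ℂ (expLp s) f
      = ∫ x, Complex.exp ((-(2 * Real.pi * s) : ℝ) * x * Complex.I) * f x ∂cantorMeasure := by
  rw [L2.inner_def]
  refine integral_congr_ae ?_
  filter_upwards [coeFn_expLp s] with x hx
  rw [hx, RCLike.inner_apply, ← Complex.exp_conj, mul_comm]
  simp only [map_mul, Complex.conj_ofReal, Complex.conj_I, map_ofNat]
  push_cast
  ring_nf

theorem inner_expLp_expLp (s t : ℝ) : inner ℂ (expLp s) (expLp t) = cantorFourier (t - s) := by
  rw [inner_expLp_left, cantorFourier, charFun_apply_real]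
  refine integral_congr_ae ?_
  filter_upwards [coeFn_expLp t] with x hx
  rw [hx, ← Complex.exp_add]
  push_cast
  ring_nf

theorem eq_zero_of_inner_expLp {f : Lp ℂ 2 cantorMeasure}
    (h : ∀ s, inner ℂ (expLp s) f = 0) : f = 0 := by
  rw [Lp.eq_zero_iff_ae_eq_zero]
  refine ae_eq_zero_of_integral_exp_mul ((Lp.memLp f).integrable (by norm_num)) fun t => ?_
  have := h (-(t / (2 * Real.pi)))
  rw [inner_expLp_left] at this
  rw [← this]
  have hpi : -(2 * Real.pi * -(t / (2 * Real.pi))) = t := by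
    field_simp
  rw [hpi]

theorem cantorFourier_zero : cantorFourier 0 = 1 := by simp [cantorFourier]

theorem cantorFourier_eq (t : ℝ) : cantorFourier t
    = (1 + Complex.exp (Real.pi * t * Complex.I)) / 2 * cantorFourier (t / 4) := by
  rw [cantorFourier, charFun_invariant isInvariantProbability_cantorMeasure, cantorFourier]
  push_cast
  rw [show 2 * (Real.pi : ℂ) * t / 2 * Complex.I = Real.pi * t * Complex.I by ring,
    show 2 * Real.pi * t / 4 = 2 * Real.pi * (t / 4) by ring]

theorem norm_expLp (s : ℝ) : ‖expLp s‖ = 1 := by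
  have h := inner_self_eq_norm_sq (𝕜 := ℂ) (expLp s)
  rw [inner_expLp_expLp, sub_self, cantorFourier_zero, RCLike.one_re] at h
  nlinarith [norm_nonneg (expLp s)]

/-- The factor `1 + exp(πit)` vanishes at odd integers, and the scaling equation carries zeros from
`t / 4` to `t`. -/
theorem cantorFourier_eq_zero {N : ℤ} (h : IsFourPowMulOdd N) : cantorFourier N = 0 := by
  obtain ⟨k, z, rfl⟩ := h
  induction k with
  | zero =>
    rw [cantorFourier_eq]
    push_cast
    rw [show (Real.pi : ℂ) * (1 * (2 * z + 1)) * Complex.I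
      = z * (2 * Real.pi * Complex.I) + Real.pi * Complex.I by ring, Complex.exp_add,
      Complex.exp_int_mul_two_pi_mul_I, Complex.exp_pi_mul_I]
    simp
  | succ k ih =>
    rw [cantorFourier_eq, show (((4 ^ (k + 1) * (2 * z + 1) : ℤ) : ℝ)) / 4
      = ((4 ^ k * (2 * z + 1) : ℤ) : ℝ) by push_cast; ring, ih, mul_zero]

theorem orthonormal_expLp {m : ℕ} (hm : Odd m) :
    Orthonormal ℂ fun γ : Gam m => expLp (γ : ℝ) := by
  refine ⟨fun γ => norm_expLp _, fun γ γ' hne => ?_⟩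
  obtain ⟨n, hn⟩ := exists_natCast_of_mem_Gam γ.2
  obtain ⟨k, hk⟩ := exists_natCast_of_mem_Gam γ'.2
  have hnk : k ≠ n := fun h => hne (Subtype.ext (by rw [hn, hk, h]))
  have := cantorFourier_eq_zero (isFourPowMulOdd_sub hm (hk ▸ γ'.2) (hn ▸ γ.2) hnk)
  rw [inner_expLp_expLp, hn, hk]
  exact_mod_cast this

theorem not_hasExtremeOrbit_of_isSpectrum {m : ℕ} (hm : Odd m)
    (h : IsSpectrum cantorMeasure (Gam m)) : ¬ HasExtremeOrbit m := by
  rintro ⟨x, hx, hor⟩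
  obtain ⟨b, hb⟩ := h
  have hbe : ∀ γ : Gam m, b γ = expLp γ := fun γ =>
    Lp.ext ((hb γ).trans (coeFn_expLp γ).symm)
  set Y : Set ℤ := Set.range fun j : ℕ => (4 ^ j * x) % (m : ℤ) with hY
  have hY0 : ∀ y ∈ Y, 0 < y := by rintro _ ⟨j, rfl⟩; exact four_pow_mul_emod_pos hm hx j
  have hYp : ∀ y ∈ Y, ∃ y' ∈ Y, 4 * y' = y ∨ 4 * y' = y + m := by
    rintro _ ⟨j, rfl⟩
    obtain ⟨i, hi⟩ := exists_pred_orbit hm hor j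
    exact ⟨_, ⟨i, rfl⟩, hi⟩
  obtain ⟨y, hy⟩ : Y.Nonempty := ⟨_, 0, rfl⟩
  have hzero : ∀ γ : Gam m, inner ℂ (expLp (-y)) (b γ) = 0 := fun γ => by
    obtain ⟨n, hn⟩ := exists_natCast_of_mem_Gam γ.2
    have := cantorFourier_eq_zero (isFourPowMulOdd_add hm hY0 hYp (hn ▸ γ.2) hy)
    rw [hbe, inner_expLp_expLp, sub_neg_eq_add, hn]
    exact_mod_cast this
  -- Parseval for a vector of norm 1 with all coefficients zero gives `0 = 1`.
  have h1 := b.tsum_inner_mul_inner (expLp (-y)) (expLp (-y))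
  rw [inner_expLp_expLp, sub_self, cantorFourier_zero] at h1
  simp [hzero] at h1

/-! ### The spectral sum and its averaging equation. -/

theorem norm_cantorFourier_sq (t : ℝ) : ‖cantorFourier t‖ ^ 2
    = Real.cos (Real.pi * t / 2) ^ 2 * ‖cantorFourier (t / 4)‖ ^ 2 := by
  rw [cantorFourier_eq, norm_mul, mul_pow]
  congr 1
  have h : (1 + Complex.exp (Real.pi * t * Complex.I)) / 2
      = Complex.exp ((Real.pi * t / 2 : ℝ) * Complex.I) * (Real.cos (Real.pi * t / 2) : ℝ) := by
    rw [Complex.ofReal_cos, Complex.cos, mul_div_assoc', mul_add, ← Complex.exp_add,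
      ← Complex.exp_add]
    push_cast
    ring_nf
    simp [add_comm]
  rw [h, norm_mul, Complex.norm_exp_ofReal_mul_I, one_mul, Complex.norm_real, Real.norm_eq_abs,
    sq_abs]

/-- The squared modulus of the Fourier transform, with values in `[0, ∞]`. -/
noncomputable def spectralWeight (t : ℝ) : ENNReal := ENNReal.ofReal (‖cantorFourier t‖ ^ 2)

theorem spectralWeight_add_four_mul (t : ℝ) (n : ℕ) : spectralWeight (t + 4 * n)
    = ENNReal.ofReal (Real.cos (Real.pi * t / 2) ^ 2) * spectralWeight (t / 4 + n) := by
  rw [spectralWeight, norm_cantorFourier_sq, ENNReal.ofReal_mul (sq_nonneg _), spectralWeight,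
    show Real.pi * (t + 4 * n) / 2 = Real.pi * t / 2 + n * (2 * Real.pi) by ring,
    Real.cos_add_nat_mul_two_pi, show (t + 4 * n) / 4 = t / 4 + n by ring]

/-- The sum of the squared moduli of the coefficients of `e_{-t}` for the family `Γ(m)`. -/
noncomputable def spectralSum (m : ℕ) (t : ℝ) : ENNReal :=
  ∑' γ : Gam m, spectralWeight (t + γ)

/-- Lower semicontinuity is all the minimum argument needs: minima exist on compact sets and
sublevel sets are closed. -/
theorem lowerSemicontinuous_spectralSum (m : ℕ) : LowerSemicontinuous (spectralSum m) := by
  refine lowerSemicontinuous_tsum fun γ => Continuous.lowerSemicontinuous ?_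
  have : Continuous (charFun cantorMeasure) := continuous_charFun
  refine ENNReal.continuous_ofReal.comp ?_
  unfold cantorFourier
  fun_prop

theorem Gam_eq_union (m : ℕ) :
    Gam m = (fun x : ℝ => 4 * x) '' Gam m ∪ (fun x : ℝ => 4 * x + m) '' Gam m := by
  ext x
  constructor
  · intro hx
    obtain ⟨y, hy, rfl | rfl⟩ := exists_eq_four_mul_add hx
    exacts [Or.inl ⟨y, hy, rfl⟩, Or.inr ⟨y, hy, rfl⟩]
  · rintro (⟨y, hy, rfl⟩ | ⟨y, hy, rfl⟩)
    · simpa using four_mul_add_mem_Gam hy (Or.inl rfl)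
    · exact four_mul_add_mem_Gam hy (Or.inr rfl)

theorem disjoint_images_Gam {m : ℕ} (hm : Odd m) :
    Disjoint ((fun x : ℝ => 4 * x) '' Gam m) ((fun x : ℝ => 4 * x + m) '' Gam m) := by
  rw [Set.disjoint_left]
  rintro _ ⟨y, hy, rfl⟩ ⟨z, hz, h⟩
  obtain ⟨n, rfl⟩ := exists_natCast_of_mem_Gam hy
  obtain ⟨k, rfl⟩ := exists_natCast_of_mem_Gam hz
  have h' : 4 * k + m = 4 * n := by
    simp only at h
    exact_mod_cast h
  obtain ⟨r, rfl⟩ := hm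
  omega

/-- Split `Γ(m)` by the lowest digit. A shift by the odd number `m` turns the cosine weight into a
sine weight. -/
theorem spectralSum_eq {m : ℕ} (hm : Odd m) (t : ℝ) : spectralSum m t
    = ENNReal.ofReal (Real.cos (Real.pi * t / 2) ^ 2) * spectralSum m (t / 4)
      + ENNReal.ofReal (Real.sin (Real.pi * t / 2) ^ 2) * spectralSum m ((t + m) / 4) := by
  have hcos : Real.cos (Real.pi * (t + m) / 2) ^ 2 = Real.sin (Real.pi * t / 2) ^ 2 := by
    obtain ⟨r, rfl⟩ := hm
    rw [show Real.pi * (t + ((2 * r + 1 : ℕ) : ℝ)) / 2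
      = (Real.pi * t / 2 + Real.pi / 2) + r * Real.pi by push_cast; ring,
      Real.cos_add_nat_mul_pi, mul_pow, ← pow_mul, mul_comm r, pow_mul, Real.cos_add_pi_div_two]
    simp
  have h1 : ∀ f : ℝ → ENNReal, ∑' x : Gam m, f x
      = ∑' x : Gam m, f (4 * x) + ∑' x : Gam m, f (4 * x + m) := fun f => by
    conv_lhs => rw [Gam_eq_union m]
    rw [ENNReal.summable.tsum_union_disjoint (f := f) (disjoint_images_Gam hm) ENNReal.summable,
      tsum_image f (fun x _ y _ h => by simpa using h),
      tsum_image f (fun x _ y _ h => by simpa using h)]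
  rw [spectralSum, h1 fun x => spectralWeight (t + x), ← hcos, spectralSum, spectralSum,
    ← ENNReal.tsum_mul_left, ← ENNReal.tsum_mul_left]
  congr 1
  · refine tsum_congr fun γ => ?_
    obtain ⟨n, hn⟩ := exists_natCast_of_mem_Gam γ.2
    rw [hn, spectralWeight_add_four_mul]
  · refine tsum_congr fun γ => ?_
    obtain ⟨n, hn⟩ := exists_natCast_of_mem_Gam γ.2
    rw [hn, add_comm (4 * (n : ℝ)), ← add_assoc, spectralWeight_add_four_mul]

theorem norm_inner_expLp_neg_sq (γ t : ℝ) :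
    ENNReal.ofReal (‖(inner ℂ (expLp γ) (expLp (-t)) : ℂ)‖ ^ 2) = spectralWeight (t + γ) := by
  rw [norm_inner_symm, inner_expLp_expLp, sub_neg_eq_add, add_comm, spectralWeight]

theorem spectralSum_le_one {m : ℕ} (hm : Odd m) (t : ℝ) : spectralSum m t ≤ 1 := by
  have hb := (orthonormal_expLp hm).tsum_inner_products_le (x := expLp (-t))
  rw [norm_expLp, one_pow] at hb
  simp only [spectralSum, ← norm_inner_expLp_neg_sq]
  rw [← ENNReal.ofReal_tsum_of_nonneg (fun _ => sq_nonneg _)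
    ((orthonormal_expLp hm).inner_products_summable _)]
  exact ENNReal.ofReal_le_one.2 hb

theorem spectralSum_zero {m : ℕ} (hm : Odd m) : spectralSum m 0 = 1 := by
  refine le_antisymm (spectralSum_le_one hm 0) ?_
  refine le_trans ?_ (ENNReal.le_tsum (⟨0, zero_mem_Gam m⟩ : Gam m))
  simp [spectralWeight, cantorFourier_zero]

/-- At a minimum of an average, all the terms of positive weight are minimal. -/
theorem le_of_average_eq {u v c x y : ℝ} (huv : u + v = 1) (hv : 0 ≤ v) (hy : c ≤ y)
    (h : c = u * x + v * y) (hu : 0 < u) : x ≤ c := by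
  by_contra hlt
  rw [not_le] at hlt
  have h1 := mul_lt_mul_of_pos_left hlt hu
  have h2 := mul_le_mul_of_nonneg_left hy hv
  have h3 : u * c + v * c = c := by rw [← add_mul, huv, one_mul]
  linarith

theorem spectralSum_eq_one {m : ℕ} (hm : Odd m) (h : ¬ HasExtremeOrbit m) (t : ℝ) :
    spectralSum m t = 1 := by
  -- Large enough to contain `t` and for both maps `r / 4` and `(r + m) / 4` to preserve `[-R, R]`.
  set R : ℝ := max |t| m with hR
  have hmR : (m : ℝ) ≤ R := le_max_right _ _
  have hm0 : (0 : ℝ) < m := by exact_mod_cast hm.pos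
  obtain ⟨s, hs, hmin⟩ := LowerSemicontinuousOn.exists_isMinOn
    (s := Set.Icc (-R) R) ⟨0, by constructor <;> linarith⟩ isCompact_Icc
    ((lowerSemicontinuous_spectralSum m).lowerSemicontinuousOn _)
  have htR : t ∈ Set.Icc (-R) R := abs_le.1 (le_max_left _ _)
  have hmin' : ∀ r ∈ Set.Icc (-R) R, spectralSum m s ≤ spectralSum m r := fun r hr => hmin hr
  refine le_antisymm (spectralSum_le_one hm t) (le_trans ?_ (hmin' t htR))
  by_contra hlt
  rw [not_le] at hlt
  set Z : Set ℝ := Set.Icc (-R) R ∩ spectralSum m ⁻¹' Set.Iic (spectralSum m s) with hZ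
  have hZc : IsClosed Z :=
    isClosed_Icc.inter ((lowerSemicontinuous_spectralSum m).isClosed_preimage _)
  have hfin : ∀ r, spectralSum m r ≠ ⊤ := fun r =>
    ((spectralSum_le_one hm r).trans_lt ENNReal.one_lt_top).ne
  have h0 : (0 : ℝ) ∉ Z := fun hz => by
    have := hz.2
    rw [Set.mem_preimage, spectralSum_zero hm] at this
    exact absurd this (not_le.2 hlt)
  have hI1 : ∀ r ∈ Set.Icc (-R) R, r / 4 ∈ Set.Icc (-R) R := fun r hr => by
    constructor <;> linarith [hr.1, hr.2]
  have hI2 : ∀ r ∈ Set.Icc (-R) R, (r + m) / 4 ∈ Set.Icc (-R) R := fun r hr => by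
    constructor <;> linarith [hr.1, hr.2]
  have hreal : ∀ r ∈ Z, (spectralSum m s).toReal
      = Real.cos (Real.pi * r / 2) ^ 2 * (spectralSum m (r / 4)).toReal
        + Real.sin (Real.pi * r / 2) ^ 2 * (spectralSum m ((r + m) / 4)).toReal := fun r hr => by
    rw [le_antisymm (hmin' r hr.1) hr.2, spectralSum_eq hm r, ENNReal.toReal_add
      (ENNReal.mul_ne_top ENNReal.ofReal_ne_top (hfin _))
      (ENNReal.mul_ne_top ENNReal.ofReal_ne_top (hfin _)), ENNReal.toReal_mul, ENNReal.toReal_mul,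
      ENNReal.toReal_ofReal (sq_nonneg _), ENNReal.toReal_ofReal (sq_nonneg _)]
  have hle : ∀ r ∈ Set.Icc (-R) R, (spectralSum m s).toReal ≤ (spectralSum m r).toReal :=
    fun r hr => (ENNReal.toReal_le_toReal (hfin _) (hfin _)).2 (hmin' r hr)
  have hmove1 : ∀ r ∈ Z, Real.cos (Real.pi * r / 2) ≠ 0 → r / 4 ∈ Z := fun r hr hc =>
    ⟨hI1 r hr.1, (ENNReal.toReal_le_toReal (hfin _) (hfin _)).1
      (le_of_average_eq (Real.cos_sq_add_sin_sq _) (sq_nonneg _) (hle _ (hI2 r hr.1))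
        (hreal r hr) (by positivity))⟩
  have hmove2 : ∀ r ∈ Z, Real.sin (Real.pi * r / 2) ≠ 0 → (r + m) / 4 ∈ Z := fun r hr hc =>
    ⟨hI2 r hr.1, (ENNReal.toReal_le_toReal (hfin _) (hfin _)).1
      (le_of_average_eq (Real.sin_sq_add_cos_sq _) (sq_nonneg _) (hle _ (hI1 r hr.1))
        ((hreal r hr).trans (add_comm _ _)) (by positivity))⟩
  have hcosint : ∀ r : ℝ, Real.cos (Real.pi * r / 2) = 0 → ∃ z : ℤ, r = 2 * z + 1 := fun r hr => by
    obtain ⟨k, hk⟩ := Real.cos_eq_zero_iff.1 hr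
    exact ⟨k, by field_simp at hk; linarith⟩
  have hsinint : ∀ r : ℝ, Real.sin (Real.pi * r / 2) = 0 → ∃ z : ℤ, r = 2 * z := fun r hr => by
    obtain ⟨k, hk⟩ := Real.sin_eq_zero_iff.1 hr
    exact ⟨k, by field_simp at hk; linarith⟩
  have hint : ∀ r ∈ Z, ∃ z : ℤ, r = z := by
    intro r hr
    by_contra hne
    -- The cosine weight vanishes only at odd integers, which no `r / 4 ^ n` is when `r` is not an
    -- integer. So the move `r / 4` is always available and leads to the limit 0, which is not in
    -- the closed set `Z`.
    have hpow : ∀ n : ℕ, r / 4 ^ n ∈ Z := fun n => by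
      induction n with
      | zero => simpa using hr
      | succ n ih =>
        rw [pow_succ, ← div_div]
        refine hmove1 _ ih fun hc => hne ?_
        obtain ⟨z, hz⟩ := hcosint _ hc
        exact ⟨4 ^ n * (2 * z + 1), by
          rw [div_eq_iff (by positivity)] at hz; rw [hz]; push_cast; ring⟩
    have hlim : Filter.Tendsto (fun n : ℕ => r / 4 ^ n) Filter.atTop (nhds 0) := by
      simpa [div_eq_mul_inv] using (tendsto_pow_atTop_nhds_zero_of_lt_one (r := (4 : ℝ)⁻¹)
        (by norm_num) (by norm_num)).const_mul r
    exact h0 (hZc.mem_of_tendsto hlim (Filter.Eventually.of_forall hpow))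
  refine h (hasExtremeOrbit_of_finite hm.pos (S := {z : ℤ | (z : ℝ) ∈ Z}) ?_ ?_ ?_ ?_)
  · refine (Set.finite_Icc ⌈-R⌉ ⌊R⌋).subset fun z hz => ?_
    exact ⟨Int.ceil_le.2 hz.1.1, Int.le_floor.2 hz.1.2⟩
  · have hsZ : s ∈ Z := ⟨hs, le_refl (spectralSum m s)⟩
    obtain ⟨z, rfl⟩ := hint s hsZ
    exact ⟨z, hsZ⟩
  · simpa using h0
  · intro z hz
    by_cases hc : Real.cos (Real.pi * z / 2) = 0
    · have hs0 : Real.sin (Real.pi * z / 2) ≠ 0 := fun hs0 => by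
        have := Real.cos_sq_add_sin_sq (Real.pi * z / 2)
        rw [hc, hs0] at this
        norm_num at this
      have hZ2 := hmove2 z hz hs0
      obtain ⟨w, hw⟩ := hint _ hZ2
      refine ⟨w, show (w : ℝ) ∈ Z from hw ▸ hZ2, Or.inr ?_⟩
      have : (4 : ℝ) * w = z + m := by rw [← hw]; ring
      exact_mod_cast this
    · have hZ1 := hmove1 z hz hc
      obtain ⟨w, hw⟩ := hint _ hZ1
      refine ⟨w, show (w : ℝ) ∈ Z from hw ▸ hZ1, Or.inl ?_⟩
      have : (4 : ℝ) * w = z := by rw [← hw]; ring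
      exact_mod_cast this

theorem isSpectrum_of_spectralSum_eq_one {m : ℕ} (hm : Odd m)
    (h : ∀ t, spectralSum m t = 1) : IsSpectrum cantorMeasure (Gam m) := by
  have hsum : ∀ t : ℝ,
      ∑' γ : Gam m, ‖(inner ℂ (expLp (γ : ℝ)) (expLp t) : ℂ)‖ ^ 2 = 1 := fun t => by
    have h1 := h (-t)
    simp only [spectralSum, ← norm_inner_expLp_neg_sq, neg_neg] at h1
    rw [← ENNReal.ofReal_tsum_of_nonneg (fun _ => sq_nonneg _)
      ((orthonormal_expLp hm).inner_products_summable _)] at h1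
    exact ENNReal.ofReal_eq_one.1 h1
  have hbot : (Submodule.span ℂ (Set.range fun γ : Gam m => expLp (γ : ℝ)))ᗮ = ⊥ := by
    rw [Submodule.eq_bot_iff]
    intro f hf
    have hfγ : ∀ γ : Gam m, inner ℂ (expLp (γ : ℝ)) f = 0 := fun γ =>
      (Submodule.mem_orthogonal _ _).1 hf _ (Submodule.subset_span ⟨γ, rfl⟩)
    refine eq_zero_of_inner_expLp fun t => ?_
    by_contra hne
    -- `c • f` is the projection of `expLp t` onto `f`. Removing it leaves all coefficients
    -- unchanged, so Bessel bounds the remaining squared norm below by 1, while Pythagoras makes it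
    -- smaller than 1.
    set c : ℂ := inner ℂ f (expLp t) / (‖f‖ : ℂ) ^ 2 with hc
    have hf0 : f ≠ 0 := by rintro rfl; simp at hne
    have hf0' : (‖f‖ : ℂ) ≠ 0 := by exact_mod_cast norm_ne_zero_iff.2 hf0
    have hne' : inner ℂ f (expLp t) ≠ 0 := fun h => hne (inner_eq_zero_symm.1 h)
    have hb := (orthonormal_expLp hm).tsum_inner_products_le (x := expLp t - c • f)
    simp only [inner_sub_right, inner_smul_right, hfγ, mul_zero, sub_zero, hsum] at hb
    have horth : inner ℂ (expLp t - c • f) (c • f) = 0 := by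
      rw [inner_eq_zero_symm, inner_smul_left, inner_sub_right, inner_smul_right,
        inner_self_eq_norm_sq_to_K, hc]
      simp [div_mul_cancel₀ _ (pow_ne_zero 2 hf0')]
    have hpyth := norm_add_sq_eq_norm_sq_add_norm_sq_of_inner_eq_zero _ _ horth
    rw [sub_add_cancel, norm_expLp] at hpyth
    have hpos : 0 < ‖c • f‖ := by
      rw [norm_pos_iff]
      exact smul_ne_zero (div_ne_zero hne' (pow_ne_zero 2 hf0')) hf0
    nlinarith
  refine ⟨HilbertBasis.mkOfOrthogonalEqBot (orthonormal_expLp hm) hbot, fun γ => ?_⟩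
  rw [HilbertBasis.coe_mkOfOrthogonalEqBot]
  exact coeFn_expLp γ

theorem isCompleteOdd_iff {m : ℕ} : IsCompleteOdd m ↔ Odd m ∧ ¬ HasExtremeOrbit m :=
  ⟨fun h => ⟨h.1, not_hasExtremeOrbit_of_isSpectrum h.1 h.2⟩,
    fun h => ⟨h.1, isSpectrum_of_spectralSum_eq_one h.1 (spectralSum_eq_one h.1 h.2)⟩⟩

end CantorFourier

theorem corollary3p17 :
    (∀ a p : ℕ, CantorFourier.IsCompleteOdd a → CantorFourier.IsSimplePrime p → 3 < p →
      ¬ p ∣ a →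
      Nat.Coprime (CantorFourier.o4 p) (CantorFourier.o4 a) →
      (2 : ℝ) ^ ⌈Real.logb 2 (Real.sqrt ((p : ℝ) / 3))⌉ < (CantorFourier.o4 p : ℝ) →
      ∀ k : ℕ, CantorFourier.IsCompleteOdd (p ^ k * a)) ∧
    (∀ p : ℕ, p.Prime → 5 < p → (CantorFourier.o4 p : ℝ) = ((p : ℝ) - 1) / 2 →
      (2 : ℝ) ^ ⌈Real.logb 2 (Real.sqrt ((p : ℝ) / 3))⌉ < (CantorFourier.o4 p : ℝ)) := by
  refine ⟨fun a p ha hp h3 _ hcop hlt k => ?_, fun p hp h5 ho => ?_⟩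
  · rw [CantorFourier.isCompleteOdd_iff] at ha ⊢
    obtain ⟨n, hn, hno⟩ := CantorFourier.exists_nat_of_two_zpow_lt hp.1 h3 hlt
    have hodd : Odd p := hp.1.odd_of_ne_two (by omega)
    exact ⟨hodd.pow.mul ha.1,
      CantorFourier.not_hasExtremeOrbit_pow_mul ha.1 hp h3 hcop hn hno ha.2 k⟩
  · rw [ho]
    exact CantorFourier.two_zpow_ceil_logb_lt hp h5
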